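/- Conventions. An alphabet is a finite set $\Sigma$ with at least two symbols, $\Sigma^*$ is the set of finite words over it, a language over $\Sigma$ is a set $L\subseteq\Sigma^*$. Polynomial time means polynomial time on a multi-tape Turing machine. A *parameter* is a polynomial-time computable function $\gamma:\Sigma^*\to\mathbb R$: from $x$ and a precision $k$ one can compute, in time polynomial in $|x|+k$, a rational number at distance at most $2^{-k}$ from $\gamma(x)$. A *P-isomorphism* is a bijection $\phi:\Sigma^*\to\Pi^*$ such that $\phi$ and $\phi^{-1}$ are polynomial-time computable; it is *preserving* from $L$ to $H$ if $x\in L\iff\phi(x)\in H$. Put $\mathcal B^\phi_n=\{x:|\phi(x)|=n\}$. *Phase transition.* $L\subseteq\Sigma^*$ exhibits a phase transition if there is a parameter $\gamma$ such that, with $S_n=\{x:\gamma(x)=n\}$ for real $n$ and $\mathcal A[S]=|S\cap L|/|S|$ (where $n$ ranges over the values that $\gamma$ takes): 1. $\mathcal A[S_n]\to1$ as $n\to\infty$, and there is a nondecreasing function of $n$ that bounds $\mathcal A[S_n]$ from below and tends to $1$ as $n\to\infty$; 2. $\mathcal A[S_n]\to0$ as $n\to-\infty$, and there is a nondecreasing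 function of $n$ (so it decreases as $n\to-\infty$) that bounds $\mathcal A[S_n]$ from above and tends to $0$ as $n\to-\infty$; 3. there is a threshold $T\in\mathbb R$ such that the number of words with $\gamma(x)\in[a,a+\delta]$ grows exponentially in $|a-T|$, beyond some distance from $T$: for each $\delta>0$ there are $r\in\mathbb R$ and $c_1,c_2,C_1,C_2>0$ such that for all real $a$ with $|a-T|\ge r$ for which $[a,a+\delta]$ contains a value of $\gamma$ this number is finite and lies between $C_1e^{c_1|a-T|}$ and $C_2e^{c_2|a-T|}$; and for some $\delta_0>0$ every interval $[a,a+\delta_0]$ with $|a-T|$ large enough contains a value of $\gamma$. *Paddable.* $L\subseteq\Sigma^*$ is paddable if there are polynomial-time computable $\mathrm{Pad}:\Sigma^*\times\Sigma^*\to\Sigma^*$ and $\mathrm{Dec}:\Sigma^*\to\Sigma^*$ with $\mathrm{Pad}(x,y)\in L\iff x\in L$ and $\mathrm{Dec}(\mathrm{Pad}(x,y))=y$ for all $x,y$. *RoughP.* A P-isomorphism $\phi:\Sigma^*\to\Sigma^*$ and a polynomial-time computable $\mathcal P:\Sigma^*\to\{\text{Accept},\text{Reject},\bot\}$ witness that $L\in$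 RoughP if $\mathcal P$ accepts only words in $L$, rejects only words not in $L$, and for some $c\in[0,1)$ the fraction of $\mathcal B^\phi_n$ on which $\mathcal P$ outputs $\bot$ is at most $c^n$ for all $n\ge1$. *Balanced.* $L$ is balanced with respect to $(\phi,\mathcal P,p)$, where $p$ is a real polynomial, if for all $n\ge1$: $p(n)>0$, at least a fraction $1/p(n)$ of $\mathcal B^\phi_n$ is in $L$ and accepted by $\mathcal P$, and at least a fraction $1/p(n)$ of $\mathcal B^\phi_n$ is outside $L$ and rejected by $\mathcal P$; and $p(n)(1/\sqrt2)^n$ is nonincreasing in $n\ge1$. *Adequately-balanced.* $L\subseteq\Sigma^*$ is adequately-balanced if it is paddable, there are $(\phi,\mathcal P)$ witnessing $L\in$ RoughP and a real polynomial $p$ such that $L$ is balanced with respect to $(\phi,\mathcal P,p)$, and, if $|\Sigma|$ is odd, moreover: 1. for some numbering $\Sigma=\{1,\dots,|\Sigma|\}$, with $\Pi=\{1,\dots,|\Sigma|+1\}$ and $\xi:\Sigma^*\to\Pi^*$ the bijection that preserves the number $\sum_j k^j[x]_j$ expressed by a word $x$ (where $k$ is the size of the alphabet), every piece $Q=\mathcal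 B^\phi_j\cap\xi^{-1}(\mathcal B^{\xi\circ\phi\circ\xi^{-1}}_m)$ with $j\ge1$, $m\ge0$ contains at least $\lfloor|Q|/p(j)\rfloor$ words in $L$ accepted by $\mathcal P$ and at least $\lfloor|Q|/p(j)\rfloor$ words outside $L$ rejected by $\mathcal P$; 2. $p$ is nondecreasing on $\mathbb N_0$ and $p'(\lambda n)\le\frac{|\ln(1/\sqrt2)|}{\lambda}p(\lambda n)$ for all $n\in\mathbb N_0$, where $\lambda=2\log_{|\Sigma|}(|\Sigma|+1)$; 3. (alt-NAEU) with $\Pi=\{1,\dots,|\Sigma|+1\}$, there are a paddable $H\subseteq\Pi^*$, a preserving-P-isomorphism $\zeta$ from $L$ to $H$, a preserving-P-isomorphism $\psi:\Pi^*\to\Pi^*$ from $H$ to $\{xx:x\in H\}\cup\{x:\omega(x)\text{ odd}\}$, where $\omega(x)$ is the sum of the symbols of $x$, and a real polynomial $q$ such that $L$ is balanced with respect to $(\phi,\mathcal Q,q)$, where $\mathcal Q(x)$ is Accept if $\omega(\psi(\zeta(x)))$ is odd, $\bot$ if $\psi(\zeta(x))$ is of the form $zz$, and Reject otherwise. **Theorem.**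 Every adequately-balanced language over an alphabet with an odd number of symbols exhibits a phase transition. -/

import Mathlib

open Filter Topology Turing Computability

noncomputable section

/-! ### Polynomial-time computability

Words over an alphabet `A` are lists `List A`, languages are `Language A`. Polynomial time means
polynomial time on a (multi-tape) Turing machine, in the length of the encoded input. -/

/-- `f` is computed in polynomial time by a Turing machine, inputs being written on the tape by
`ea` and outputs by `eb`. -/
def IsPolyTime {α β αΓ βΓ : Type} (ea : α → List αΓ) (eb : β → List βΓ) (f : α → β) : Prop :=
  Nonempty (TM2ComputableInPolyTime ea eb f)

/-- A polynomial-time map from words to words. -/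
def IsPolyTimeWordMap {A B : Type} (f : List A → List B) : Prop :=
  IsPolyTime (encodingList A).encode (encodingList B).encode f

/-- A polynomial-time map from pairs of words to words. -/
def IsPolyTimePairMap {A B : Type} (f : List A × List A → List B) : Prop :=
  IsPolyTime (encodingProd (encodingList A) (encodingList A)).encode (encodingList B).encode f

/-- Rational numbers written as a sign bit, the binary numerator and the binary denominator. -/
def ratCode (q : ℚ) : List ((Bool ⊕ Bool) ⊕ Bool) :=
  (encodingProd (encodingProd encodingBoolBool encodingNatBool) encodingNatBool).encode
    ((decide (q < 0), q.num.natAbs), q.den)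

/-- A parameter: a real-valued function on words that is computable in polynomial time, that is,
from a word `x` and a precision `k` in unary a rational number within `2 ^ (-k)` of `γ x` can be
computed in time polynomial in `|x| + k`. -/
def IsParameter {A : Type} (γ : List A → ℝ) : Prop :=
  ∃ q : List A × ℕ → ℚ,
    IsPolyTime (encodingProd (encodingList A) unaryEncodingNat).encode ratCode q ∧
    ∀ (x : List A) (k : ℕ), |γ x - (q (x, k) : ℝ)| ≤ (1 / 2 : ℝ) ^ k

/-! ### Phase transitions -/

/-- The fraction of the words of `S` that are in `T` (meaningful for finite nonempty `S`). -/
def fractionOf {A : Type} (S T : Set (List A)) : ℝ :=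
  ((S ∩ T).ncard : ℝ) / (S.ncard : ℝ)

/-- The accepting fraction of a set of words relative to a language. -/
def acceptingFraction {A : Type} (L : Language A) (S : Set (List A)) : ℝ :=
  fractionOf S {x | x ∈ L}

/-- The words at which the parameter takes the value `n`. -/
def parameterSlice {A : Type} (γ : List A → ℝ) (n : ℝ) : Set (List A) :=
  {x | γ x = n}

/-- The words at which the parameter takes a value between `a` and `a + δ`. -/
def parameterWindow {A : Type} (γ : List A → ℝ) (a δ : ℝ) : Set (List A) :=
  {x | γ x ∈ Set.Icc a (a + δ)}

/-- The number of words whose parameter lies in a window of fixed width grows exponentially with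
the distance of the window from the threshold `T`, beyond some distance from `T`, on both sides.
Windows in which the parameter takes no value are not counted, but windows of some width `δ₀` are
never of this kind. -/
def GrowsExponentiallyFrom {A : Type} (γ : List A → ℝ) (T : ℝ) : Prop :=
  (∃ δ₀ r : ℝ, 0 < δ₀ ∧ ∀ a : ℝ, r ≤ |a - T| → (parameterWindow γ a δ₀).Nonempty) ∧
  ∀ δ : ℝ, 0 < δ → ∃ r c₁ c₂ C₁ C₂ : ℝ, 0 < c₁ ∧ 0 < c₂ ∧ 0 < C₁ ∧ 0 < C₂ ∧
    ∀ a : ℝ, r ≤ |a - T| → (parameterWindow γ a δ).Nonempty →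
      (parameterWindow γ a δ).Finite ∧
      C₁ * Real.exp (c₁ * |a - T|) ≤ ((parameterWindow γ a δ).ncard : ℝ) ∧
      ((parameterWindow γ a δ).ncard : ℝ) ≤ C₂ * Real.exp (c₂ * |a - T|)

/-- The language exhibits a phase transition. The accepting fraction of a slice is considered at
those `n` at which the slice is nonempty; by the third condition such `n` exist beyond every bound
in both directions, and all slices far from the threshold are finite. -/
def ExhibitsPhaseTransition {A : Type} (L : Language A) : Prop :=
  ∃ γ : List A → ℝ, IsParameter γ ∧
    (Tendsto (fun n : ℝ => acceptingFraction L (parameterSlice γ n))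
        (atTop ⊓ 𝓟 {n | (parameterSlice γ n).Nonempty}) (𝓝 1) ∧
      ∃ lower : ℝ → ℝ, Monotone lower ∧ Tendsto lower atTop (𝓝 1) ∧
        ∀ n : ℝ, (parameterSlice γ n).Nonempty → (parameterSlice γ n).Finite →
          lower n ≤ acceptingFraction L (parameterSlice γ n)) ∧
    (Tendsto (fun n : ℝ => acceptingFraction L (parameterSlice γ n))
        (atBot ⊓ 𝓟 {n | (parameterSlice γ n).Nonempty}) (𝓝 0) ∧
      ∃ upper : ℝ → ℝ, Monotone upper ∧ Tendsto upper atBot (𝓝 0) ∧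
        ∀ n : ℝ, (parameterSlice γ n).Nonempty → (parameterSlice γ n).Finite →
          acceptingFraction L (parameterSlice γ n) ≤ upper n) ∧
    ∃ T : ℝ, GrowsExponentiallyFrom γ T

/-! ### P-isomorphisms, paddability, RoughP -/

/-- A P-isomorphism: a bijection computable in polynomial time in both directions. -/
def IsPIsomorphism {A B : Type} (φ : List A ≃ List B) : Prop :=
  IsPolyTimeWordMap φ ∧ IsPolyTimeWordMap φ.symm

/-- A preserving-P-isomorphism from `L` to `H`. -/
def IsPreservingPIsomorphism {A B : Type} (L : Language A) (H : Language B)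
    (φ : List A ≃ List B) : Prop :=
  IsPIsomorphism φ ∧ ∀ x, x ∈ L ↔ φ x ∈ H

/-- The set of words whose image under `φ` has length `n`. -/
def sizeClass {A B : Type} (φ : List A ≃ List B) (n : ℕ) : Set (List A) :=
  {x | (φ x).length = n}

/-- Paddable languages. -/
def IsPaddable {A : Type} (L : Language A) : Prop :=
  ∃ (pad : List A × List A → List A) (dec : List A → List A),
    IsPolyTimePairMap pad ∧ IsPolyTimeWordMap dec ∧
    ∀ x y, (pad (x, y) ∈ L ↔ x ∈ L) ∧ dec (pad (x, y)) = y

/-- The possible outputs of an errorless heuristic. -/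
inductive Verdict : Type
  | accept
  | reject
  | undecided

/-- The P-isomorphism `φ` and the errorless heuristic `P` witness that `L` is in RoughP. -/
def IsRoughPWitness {A : Type} (L : Language A) (φ : List A ≃ List A) (P : List A → Verdict) :
    Prop :=
  IsPIsomorphism φ ∧
  IsPolyTime (encodingList A).encode (fun v : Verdict => [v]) P ∧
  (∀ x, P x = Verdict.accept → x ∈ L) ∧
  (∀ x, P x = Verdict.reject → x ∉ L) ∧
  ∃ c : ℝ, 0 ≤ c ∧ c < 1 ∧
    ∀ n : ℕ, 1 ≤ n → fractionOf (sizeClass φ n) {x | P x = Verdict.undecided} ≤ c ^ n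

/-! ### Not-anywhere-exponentially-unbalanced languages -/

/-- The words of `L` that `P` decides correctly. -/
def correctlyAccepted {A : Type} (L : Language A) (P : List A → Verdict) : Set (List A) :=
  {x | P x = Verdict.accept ∧ x ∈ L}

/-- The words outside `L` that `P` decides correctly. -/
def correctlyRejected {A : Type} (L : Language A) (P : List A → Verdict) : Set (List A) :=
  {x | P x = Verdict.reject ∧ x ∉ L}

/-- For every `n ≥ 1`, both fractions of the `n`-th size class, correctly accepted and correctly
rejected, are at least `1 / p n`, and `p n * (1 / √2) ^ n` is decreasing. (The size class for
`n = 0` is a single word, so that one of its two fractions is always zero.) -/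
def IsBalancedBy {A : Type} (L : Language A) (φ : List A ≃ List A) (P : List A → Verdict)
    (p : Polynomial ℝ) : Prop :=
  (∀ n : ℕ, 1 ≤ n → 0 < p.eval (n : ℝ) ∧
    (p.eval (n : ℝ))⁻¹ ≤ fractionOf (sizeClass φ n) (correctlyAccepted L P) ∧
    (p.eval (n : ℝ))⁻¹ ≤ fractionOf (sizeClass φ n) (correctlyRejected L P)) ∧
  AntitoneOn (fun n : ℕ => p.eval (n : ℝ) * (1 / √2 : ℝ) ^ n) (Set.Ici 1)

/-- The sum of the symbols of a word over the alphabet `{1, …, k}`; the symbol `i : Fin k` stands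
for the number `i + 1`. -/
def symbolSum {k : ℕ} (w : List (Fin k)) : ℕ :=
  (w.map fun i => (i : ℕ) + 1).sum

/-- The language `{xx | x ∈ H} ∪ {x | the symbol sum of x is odd}`. -/
def doubledLanguage {k : ℕ} (H : Language (Fin k)) : Language (Fin k) :=
  {w | (∃ x ∈ H, w = x ++ x) ∨ Odd (symbolSum w)}

open Classical in
/-- The standard RoughP algorithm obtained from a preserving-P-isomorphism `ψ` from a language `H`
to `doubledLanguage H`: accept if `ψ y` has odd symbol sum, otherwise reject unless `ψ y` is a
doubled word. -/
def doublingAlgorithm {k : ℕ} (ψ : List (Fin k) ≃ List (Fin k)) (y : List (Fin k)) : Verdict :=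
  if Odd (symbolSum (ψ y)) then Verdict.accept
  else if ∃ z, ψ y = z ++ z then Verdict.undecided
  else Verdict.reject

/-- alt-NAEU: the balance condition holds when the algorithm is replaced by one that first applies a
preserving-P-isomorphism `ζ` to a paddable language `H` over an alphabet with one symbol more and
then a standard RoughP algorithm for `H`. -/
def IsAltNAEU {A : Type} [Fintype A] (L : Language A) (φ : List A ≃ List A) : Prop :=
  ∃ (H : Language (Fin (Fintype.card A + 1)))
    (ζ : List A ≃ List (Fin (Fintype.card A + 1)))
    (ψ : List (Fin (Fintype.card A + 1)) ≃ List (Fin (Fintype.card A + 1)))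
    (p : Polynomial ℝ),
    IsPaddable H ∧ IsPreservingPIsomorphism L H ζ ∧
    IsPreservingPIsomorphism H (doubledLanguage H) ψ ∧
    IsBalancedBy L φ (fun x => doublingAlgorithm ψ (ζ x)) p

/-! ### Reading words as numbers -/

/-- The number that a word over the alphabet `{1, …, k}` expresses in base `k`, least significant
symbol first. -/
def wordValue {k : ℕ} : List (Fin k) → ℕ
  | [] => 0
  | i :: w => ((i : ℕ) + 1) + k * wordValue w

/-- The word over the alphabet `{1, …, k}` that expresses a given number in base `k`. -/
def valueWord (k : ℕ) [NeZero k] : ℕ → List (Fin k)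
  | 0 => []
  | n + 1 => Fin.ofNat k n :: valueWord k (n / k)
decreasing_by exact Nat.lt_succ_of_le (Nat.div_le_self n k)

theorem wordValue_valueWord (k : ℕ) [NeZero k] (n : ℕ) : wordValue (valueWord k n) = n := by
  induction n using Nat.strong_induction_on with
  | _ n ih =>
    cases n with
    | zero => simp [valueWord, wordValue]
    | succ n =>
      rw [valueWord, wordValue, ih _ (Nat.lt_succ_of_le (Nat.div_le_self n k)), Fin.val_ofNat]
      have := Nat.mod_add_div n k
      omega

theorem valueWord_wordValue (k : ℕ) [NeZero k] (w : List (Fin k)) :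
    valueWord k (wordValue w) = w := by
  induction w with
  | nil => simp [valueWord, wordValue]
  | cons i w ih =>
    have h : wordValue (i :: w) = ((i : ℕ) + k * wordValue w) + 1 := by
      rw [wordValue]; omega
    have hk : 0 < k := Nat.pos_of_ne_zero (NeZero.ne k)
    rw [h, valueWord, Nat.add_mul_div_left _ _ hk, Nat.div_eq_of_lt i.isLt, Nat.zero_add, ih]
    congr 1
    apply Fin.ext
    simp [Nat.mod_eq_of_lt i.isLt]

/-- Words over `{1, …, k}` correspond to natural numbers. -/
def wordEquivNat (k : ℕ) [NeZero k] : List (Fin k) ≃ ℕ where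
  toFun := wordValue
  invFun := valueWord k
  left_inv := valueWord_wordValue k
  right_inv := wordValue_valueWord k

/-- The P-isomorphism `ξ` from words over an alphabet with `k` symbols, numbered by `e`, to words
over the alphabet `{1, …, k + 1}`: read the word as a number in base `k` and write this number in
base `k + 1`. -/
def rebase {A : Type} {k : ℕ} [NeZero k] (e : A ≃ Fin k) : List A ≃ List (Fin (k + 1)) :=
  ((Equiv.listEquivOfEquiv e).trans (wordEquivNat k)).trans (wordEquivNat (k + 1)).symm

/-! ### Adequately-balanced languages -/

/-- The part of the `j`-th size class of `φ` that `ξ` maps into the `m`-th size class of the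
conjugate `ξ ∘ φ ∘ ξ⁻¹`. -/
def sizeClassPiece {A : Type} {k : ℕ} [NeZero k] (e : A ≃ Fin k) (φ : List A ≃ List A)
    (j m : ℕ) : Set (List A) :=
  sizeClass φ j ∩
    (rebase e) ⁻¹' (sizeClass (((rebase e).symm.trans φ).trans (rebase e)) m)

/-- The correctly accepted and the correctly rejected words of each size class are spread over its
pieces in such a way that every piece keeps a fraction of at least `1 / p j` of each kind, up to
rounding down the number of words (there are one-word pieces). -/
def SplitsProportionately {A : Type} {k : ℕ} [NeZero k] (e : A ≃ Fin k) (L : Language A)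
    (φ : List A ≃ List A) (P : List A → Verdict) (p : Polynomial ℝ) : Prop :=
  ∀ j m : ℕ, 1 ≤ j →
    ⌊((sizeClassPiece e φ j m).ncard : ℝ) / p.eval (j : ℝ)⌋₊ ≤
        (sizeClassPiece e φ j m ∩ correctlyAccepted L P).ncard ∧
    ⌊((sizeClassPiece e φ j m).ncard : ℝ) / p.eval (j : ℝ)⌋₊ ≤
        (sizeClassPiece e φ j m ∩ correctlyRejected L P).ncard

/-- The requirement on the polynomial for an alphabet with `k` symbols, where
`l = 2 * log_k (k + 1)`. -/
def GrowsModerately (k : ℕ) (p : Polynomial ℝ) : Prop :=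
  Monotone (fun n : ℕ => p.eval (n : ℝ)) ∧
  ∀ n : ℕ,
    p.derivative.eval (2 * Real.logb k (k + 1) * n) ≤
      |Real.log (1 / √2)| / (2 * Real.logb k (k + 1)) *
        p.eval (2 * Real.logb k (k + 1) * n)

/-- Adequately-balanced languages. -/
def IsAdequatelyBalanced {A : Type} [Fintype A] [NeZero (Fintype.card A)] (L : Language A) :
    Prop :=
  IsPaddable L ∧
  ∃ (φ : List A ≃ List A) (P : List A → Verdict) (p : Polynomial ℝ),
    IsRoughPWitness L φ P ∧ IsBalancedBy L φ P p ∧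
    (Odd (Fintype.card A) →
      (∃ e : A ≃ Fin (Fintype.card A), SplitsProportionately e L φ P p) ∧
      GrowsModerately (Fintype.card A) p ∧
      IsAltNAEU L φ)

end

/-!
A language `L` with a RoughP witness `(φ, P)` for which it is balanced is split by the parameter
`γ x = |φ x| + 1` where `P` does not reject and `γ x = -(|φ x| + 1)` where it does. The slice of `γ`
at a negative value consists of rejected words, none of which is in `L`. A word outside `L` in the
slice at `n + 1` is one at which `P` is undecided, and those are at most a fraction `c ^ n` of the
size class, whereas the slice contains at least a fraction `1 / p n` of it. So its accepting
fraction is at least `1 - p n * c ^ n` (`one_sub_le_acceptingFraction`), which tends to `1`, and the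
supremum of a tail of `p n * c ^ n` gives the monotone bound (`exists_antitone_majorant`). As
`p n * (1 / √2) ^ n` is nonincreasing, a slice at `±(n + 1)` has at least `√2 ^ n` words up to a
constant, while at most `(2 * |Σ|) ^ n` words have `|φ x| ≤ n`, which is the growth condition with
threshold `0` (`growsExponentiallyFrom_verdictParameter`).

The larger part of the work is to show that `γ` is computable in polynomial time
(`isPolyTime_signedLength`). One stack machine copies the word to the input stacks of the machines
for `φ` and for `P`, runs the two one after the other on their own stacks (`shows_iterate`), counts
the symbols of the first output in binary, and prints the counter with the sign that the second
output gives. Since each step of a machine pushes a bounded number of symbols, the length of `φ x`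
is polynomially bounded (`SignedLength.exists_output_length_le`), so that the counting, too, takes
polynomial time.
-/

noncomputable section

/-! ### Reachability within a time bound -/

/-- `b` is reached from `a` by at most `n` applications of the partial step function `f`. -/
def ReachesIn {S : Type} (f : S → Option S) (n : ℕ) (a b : S) : Prop :=
  ∃ m ≤ n, (flip Bind.bind f)^[m] (some a) = some b

namespace ReachesIn

variable {S : Type} {f : S → Option S} {n m : ℕ} {a b c : S}

theorem refl (a : S) : ReachesIn f 0 a a := ⟨0, le_rfl, rfl⟩

theorem mono (h : ReachesIn f n a b) (hnm : n ≤ m) : ReachesIn f m a b :=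
  let ⟨k, hk, e⟩ := h
  ⟨k, hk.trans hnm, e⟩

theorem trans (h₁ : ReachesIn f n a b) (h₂ : ReachesIn f m b c) : ReachesIn f (n + m) a c := by
  obtain ⟨k, hk, e⟩ := h₁
  obtain ⟨l, hl, e'⟩ := h₂
  exact ⟨l + k, by omega, by rw [Function.iterate_add_apply, e, e']⟩

theorem single (h : f a = some b) : ReachesIn f 1 a b := ⟨1, le_rfl, h⟩

theorem head (h : f a = some b) (h' : ReachesIn f n b c) : ReachesIn f (n + 1) a c :=
  ((single h).trans h').mono (by omega)

end ReachesIn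

theorem iterate_bind_none {S : Type} (f : S → Option S) (n : ℕ) :
    (flip Bind.bind f)^[n] none = none := by
  induction n with
  | zero => rfl
  | succ n ih => exact ih

/-! ### Running a stack machine inside a larger one -/

section Embedding

variable {K K' : Type} [DecidableEq K'] {Γ' : K' → Type} {Λ Λ' σ σ' ρ : Type}

/-- The statement of a large machine that performs a statement of a small one. The stack `k` of the
small machine is the stack `ι k` of the large one, its memory is the first component of the
memory of the large machine under `e`, its labels are renamed by `lab`, and instead of halting it
jumps to the label `exit`. -/
def embedStmt (ι : K → K') (e : σ' ≃ σ × ρ) (lab : Λ → Λ') (exit : Λ') :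
    TM2.Stmt (fun k => Γ' (ι k)) Λ σ → TM2.Stmt Γ' Λ' σ'
  | .push k f q => .push (ι k) (fun v => f (e v).1) (embedStmt ι e lab exit q)
  | .peek k f q =>
      .peek (ι k) (fun v x => e.symm (f (e v).1 x, (e v).2)) (embedStmt ι e lab exit q)
  | .pop k f q =>
      .pop (ι k) (fun v x => e.symm (f (e v).1 x, (e v).2)) (embedStmt ι e lab exit q)
  | .load f q => .load (fun v => e.symm (f (e v).1, (e v).2)) (embedStmt ι e lab exit q)
  | .branch p q₁ q₂ =>
      .branch (fun v => p (e v).1) (embedStmt ι e lab exit q₁) (embedStmt ι e lab exit q₂)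
  | .goto f => .goto fun v => lab (f (e v).1)
  | .halt => .goto fun _ => exit

/-- The configuration `c'` of the large machine shows the configuration `c` of the small one, and
agrees with `r` and `F` in the part of the memory and on the stacks that the small machine does not
touch. -/
structure Shows (ι : K → K') (e : σ' ≃ σ × ρ) (lab : Λ → Λ') (exit : Λ') (r : ρ)
    (F : ∀ k, List (Γ' k)) (c : TM2.Cfg (fun k => Γ' (ι k)) Λ σ) (c' : TM2.Cfg Γ' Λ' σ') :
    Prop where
  label : c'.l = some (c.l.elim exit lab)
  var : e c'.var = (c.var, r)
  stk : ∀ k, c'.stk (ι k) = c.stk k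
  frame : ∀ k, k ∉ Set.range ι → c'.stk k = F k

variable {ι : K → K'} {e : σ' ≃ σ × ρ} {lab : Λ → Λ'} {exit : Λ'} {r : ρ} {F : ∀ k, List (Γ' k)}

theorem update_comp_embedding [DecidableEq K] (hι : Function.Injective ι) {S : ∀ k, List (Γ' (ι k))}
    {S' : ∀ k, List (Γ' k)} (hS : ∀ k, S' (ι k) = S k) (k : K) (x : List (Γ' (ι k))) (j : K) :
    Function.update S' (ι k) x (ι j) = Function.update S k x j := by
  by_cases h : j = k
  · subst h; simp
  · rw [Function.update_of_ne (hι.ne h), Function.update_of_ne h, hS]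

theorem update_frame {S' : ∀ k, List (Γ' k)} (hF : ∀ k, k ∉ Set.range ι → S' k = F k) (k : K)
    (x : List (Γ' (ι k))) (j : K') (hj : j ∉ Set.range ι) :
    Function.update S' (ι k) x j = F j := by
  rw [Function.update_of_ne (fun h => hj ⟨k, h.symm⟩), hF j hj]

theorem shows_stepAux [DecidableEq K] (hι : Function.Injective ι)
    (q : TM2.Stmt (fun k => Γ' (ι k)) Λ σ) (v : σ)
    (v' : σ') (S : ∀ k, List (Γ' (ι k))) (S' : ∀ k, List (Γ' k)) (hv : e v' = (v, r))
    (hS : ∀ k, S' (ι k) = S k) (hF : ∀ k, k ∉ Set.range ι → S' k = F k) :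
    Shows ι e lab exit r F (TM2.stepAux q v S)
      (TM2.stepAux (embedStmt ι e lab exit q) v' S') := by
  induction q generalizing v v' S S' with
  | push k f q ih =>
    refine ih _ _ _ _ hv (fun j => ?_) (update_frame hF k _)
    rw [update_comp_embedding hι hS]
    simp only [hv, hS]
  | peek k f q ih =>
    exact ih _ _ _ _ (by simp [hv, hS]) hS hF
  | pop k f q ih =>
    refine ih _ _ _ _ (by simp [hv, hS]) (fun j => ?_) (update_frame hF k _)
    rw [update_comp_embedding hι hS, hS]
  | load f q ih =>
    exact ih _ _ _ _ (by simp [hv]) hS hF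
  | branch p q₁ q₂ ih₁ ih₂ =>
    simp only [embedStmt, TM2.stepAux, hv]
    cases p v
    · exact ih₂ _ _ _ _ hv hS hF
    · exact ih₁ _ _ _ _ hv hS hF
  | goto f => exact ⟨by simp [embedStmt, hv], by simpa [embedStmt] using hv, hS, hF⟩
  | halt => exact ⟨by simp [embedStmt], by simpa [embedStmt] using hv, hS, hF⟩

/-- A run of the small machine is a run of the large one of the same length; where the small
machine halts, the large one is at the label `exit`. -/
theorem shows_iterate [DecidableEq K] (hι : Function.Injective ι)
    {M : Λ → TM2.Stmt (fun k => Γ' (ι k)) Λ σ}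
    {M' : Λ' → TM2.Stmt Γ' Λ' σ'} (hM : ∀ l, M' (lab l) = embedStmt ι e lab exit (M l)) (n : ℕ)
    {c d : TM2.Cfg (fun k => Γ' (ι k)) Λ σ} {c' : TM2.Cfg Γ' Λ' σ'}
    (h : (flip Bind.bind (TM2.step M))^[n] (some c) = some d)
    (hc : Shows ι e lab exit r F c c') :
    ∃ d', ReachesIn (TM2.step M') n c' d' ∧ Shows ι e lab exit r F d d' := by
  induction n generalizing c c' with
  | zero =>
    obtain rfl : c = d := Option.some.inj h
    exact ⟨c', .refl _, hc⟩
  | succ n ih =>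
    rw [Function.iterate_succ_apply] at h
    obtain ⟨l, v, S⟩ := c
    obtain ⟨l', v', S'⟩ := c'
    cases l with
    | none => exact absurd ((iterate_bind_none _ n).symm.trans h) (by simp)
    | some l =>
      obtain ⟨h₁, h₂, h₃, h₄⟩ := hc
      obtain rfl : l' = some (lab l) := h₁
      obtain ⟨d', hd, hs⟩ := ih (c := TM2.stepAux (M l) v S)
        (c' := TM2.stepAux (M' (lab l)) v' S') h
        (by rw [hM]; exact shows_stepAux hι _ _ _ _ _ h₂ h₃ h₄)
      exact ⟨d', hd.head rfl, hs⟩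

end Embedding

/-! ### Output length -/

section OutputLength

variable {K : Type} [DecidableEq K] {Γ : K → Type} {Λ σ : Type}

/-- The number of push instructions in a statement. -/
def pushCount : TM2.Stmt Γ Λ σ → ℕ
  | .push _ _ q => pushCount q + 1
  | .peek _ _ q => pushCount q
  | .pop _ _ q => pushCount q
  | .load _ q => pushCount q
  | .branch _ q₁ q₂ => pushCount q₁ + pushCount q₂
  | .goto _ => 0
  | .halt => 0

theorem length_stk_stepAux_le (q : TM2.Stmt Γ Λ σ) (v : σ) (S : ∀ k, List (Γ k)) (k : K) :
    ((TM2.stepAux q v S).stk k).length ≤ (S k).length + pushCount q := by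
  induction q generalizing v S with
  | push j f q ih =>
    refine (ih _ _).trans ?_
    by_cases h : k = j
    · subst h; simp [pushCount]; omega
    · rw [Function.update_of_ne h, pushCount]; omega
  | peek j f q ih => exact ih _ _
  | pop j f q ih =>
    refine (ih _ _).trans ?_
    by_cases h : k = j
    · subst h; simp [pushCount]
    · rw [Function.update_of_ne h, pushCount]
  | load f q ih => exact ih _ _
  | branch p q₁ q₂ ih₁ ih₂ =>
    simp only [TM2.stepAux, pushCount]
    cases p v
    · exact (ih₂ _ _).trans (by omega)
    · exact (ih₁ _ _).trans (by omega)
  | goto f => simp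
  | halt => simp

/-- Stacks grow at most linearly with time. (One step may push several symbols, but no more than
the statement has push instructions.) -/
theorem length_stk_iterate_le {M : Λ → TM2.Stmt Γ Λ σ} {C : ℕ} (hC : ∀ l, pushCount (M l) ≤ C)
    (n : ℕ) {c d : TM2.Cfg Γ Λ σ} (h : (flip Bind.bind (TM2.step M))^[n] (some c) = some d)
    (k : K) : (d.stk k).length ≤ (c.stk k).length + C * n := by
  induction n generalizing c with
  | zero =>
    obtain rfl : c = d := Option.some.inj h
    simp
  | succ n ih =>
    rw [Function.iterate_succ_apply] at h
    obtain ⟨l, v, S⟩ := c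
    cases l with
    | none => exact absurd ((iterate_bind_none _ n).symm.trans h) (by simp)
    | some l =>
      have h₁ := ih (c := TM2.stepAux (M l) v S) h
      have h₂ := length_stk_stepAux_le (M l) v S k
      have h₃ := hC l
      rw [Nat.mul_succ]
      dsimp only at h₁ h₂ ⊢
      omega

end OutputLength

/-! ### Binary counting -/

/-- The successor on binary numbers, least significant digit first. -/
def binarySucc : List Bool → List Bool
  | [] => [true]
  | false :: l => true :: l
  | true :: l => false :: binarySucc l

theorem encodePosNum_succ (p : PosNum) : encodePosNum p.succ = binarySucc (encodePosNum p) := by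
  induction p with
  | one => rfl
  | bit0 p ih => rfl
  | bit1 p ih => simp [PosNum.succ, encodePosNum, binarySucc, ih]

theorem encodeNat_succ (n : ℕ) : encodeNat (n + 1) = binarySucc (encodeNat n) := by
  have h : ((n + 1 : ℕ) : Num) = Num.succ n := by rw [Nat.cast_succ, Num.add_one]
  rw [encodeNat, encodeNat, h]
  cases (n : Num) with
  | zero => rfl
  | pos p => exact encodePosNum_succ p

theorem length_binarySucc_le (l : List Bool) : (binarySucc l).length ≤ l.length + 1 := by
  induction l with
  | nil => simp [binarySucc]
  | cons b l ih => cases b <;> simp [binarySucc, ih]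

theorem length_encodeNat_le (n : ℕ) : (encodeNat n).length ≤ n := by
  induction n with
  | zero => simp [encodeNat, encodeNum]
  | succ n ih =>
    rw [encodeNat_succ]
    exact (length_binarySucc_le _).trans (by omega)

theorem encodeNat_one : encodeNat 1 = [true] := by
  simp [encodeNat, encodeNum, encodePosNum]

/-! ### A machine for the signed length -/

/-- The stacks of the signed length machine besides those of the two machines that it runs. -/
inductive AuxStack : Type
  | inp
  | tmp
  | counter
  | carried
  | out
  deriving DecidableEq

instance : Fintype AuxStack :=
  ⟨{.inp, .tmp, .counter, .carried, .out}, fun x => by cases x <;> decide⟩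

/-- The phases of the signed length machine in which neither of the two machines runs. -/
inductive Phase : Type
  | read
  | copy
  | count
  | carry
  | restore
  | flip
  | emit
  deriving DecidableEq

instance : Fintype Phase :=
  ⟨{.read, .copy, .count, .carry, .restore, .flip, .emit}, fun x => by cases x <;> decide⟩

namespace SignedLength

variable (T₁ T₂ : FinTM2) (A : Type)

/-- The alphabets of the stacks. -/
abbrev Sym : T₁.K ⊕ T₂.K ⊕ AuxStack → Type
  | .inl k => T₁.Γ k
  | .inr (.inl k) => T₂.Γ k
  | .inr (.inr .inp) => A ⊕ Bool
  | .inr (.inr .tmp) => A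
  | .inr (.inr .counter) => Bool
  | .inr (.inr .carried) => Bool
  | .inr (.inr .out) => (Bool ⊕ Bool) ⊕ Bool

/-- The labels: a phase, or a label of one of the two machines. -/
abbrev Label : Type := Phase ⊕ T₁.Λ ⊕ T₂.Λ

/-- The memory: those of the two machines and a register for the symbol read last. -/
abbrev Memory : Type := T₁.σ × T₂.σ × Option (A ⊕ Bool)

/-- The memory of the first machine as a component of the whole memory. -/
def memoryFst : Memory T₁ T₂ A ≃ T₁.σ × (T₂.σ × Option (A ⊕ Bool)) := Equiv.refl _

/-- The memory of the second machine as a component of the whole memory. -/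
def memorySnd : Memory T₁ T₂ A ≃ T₂.σ × (T₁.σ × Option (A ⊕ Bool)) where
  toFun v := (v.2.1, v.1, v.2.2)
  invFun v := (v.2.1, v.1, v.2.2)
  left_inv _ := rfl
  right_inv _ := rfl

variable {T₁ T₂ A}

/-- The contents of all the stacks. -/
def contents (S₁ : ∀ k, List (T₁.Γ k)) (S₂ : ∀ k, List (T₂.Γ k)) (i : List (A ⊕ Bool)) (t : List A)
    (c r : List Bool) (o : List ((Bool ⊕ Bool) ⊕ Bool)) : ∀ k, List (Sym T₁ T₂ A k)
  | .inl k => S₁ k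
  | .inr (.inl k) => S₂ k
  | .inr (.inr .inp) => i
  | .inr (.inr .tmp) => t
  | .inr (.inr .counter) => c
  | .inr (.inr .carried) => r
  | .inr (.inr .out) => o

section Update

variable (S₁ : ∀ k, List (T₁.Γ k)) (S₂ : ∀ k, List (T₂.Γ k)) (i : List (A ⊕ Bool)) (t : List A)
    (c r : List Bool) (o : List ((Bool ⊕ Bool) ⊕ Bool))

theorem update_fst (k : T₁.K) (x : List (T₁.Γ k)) :
    Function.update (contents S₁ S₂ i t c r o) (.inl k) x =
      contents (Function.update S₁ k x) S₂ i t c r o := by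
  funext j
  rcases j with j | j | j
  · by_cases h : j = k
    · subst h; simp [contents]
    · rw [Function.update_of_ne (by simpa using h)]
      simp [contents, h]
  · rfl
  · cases j <;> rfl

theorem update_snd (k : T₂.K) (x : List (T₂.Γ k)) :
    Function.update (contents S₁ S₂ i t c r o) (.inr (.inl k)) x =
      contents S₁ (Function.update S₂ k x) i t c r o := by
  funext j
  rcases j with j | j | j
  · rfl
  · by_cases h : j = k
    · subst h; simp [contents]
    · rw [Function.update_of_ne (by simpa using h)]
      simp [contents, h]
  · cases j <;> rfl

theorem update_inp (x : List (A ⊕ Bool)) :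
    Function.update (contents S₁ S₂ i t c r o) (.inr (.inr .inp)) x = contents S₁ S₂ x t c r o := by
  funext j
  rcases j with j | j | j <;> first | rfl | (cases j <;> rfl)

theorem update_tmp (x : List A) :
    Function.update (contents S₁ S₂ i t c r o) (.inr (.inr .tmp)) x = contents S₁ S₂ i x c r o := by
  funext j
  rcases j with j | j | j <;> first | rfl | (cases j <;> rfl)

theorem update_counter (x : List Bool) :
    Function.update (contents S₁ S₂ i t c r o) (.inr (.inr .counter)) x =
      contents S₁ S₂ i t x r o := by
  funext j
  rcases j with j | j | j <;> first | rfl | (cases j <;> rfl)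

theorem update_carried (x : List Bool) :
    Function.update (contents S₁ S₂ i t c r o) (.inr (.inr .carried)) x =
      contents S₁ S₂ i t c x o := by
  funext j
  rcases j with j | j | j <;> first | rfl | (cases j <;> rfl)

theorem update_out (x : List ((Bool ⊕ Bool) ⊕ Bool)) :
    Function.update (contents S₁ S₂ i t c r o) (.inr (.inr .out)) x = contents S₁ S₂ i t c r x := by
  funext j
  rcases j with j | j | j <;> first | rfl | (cases j <;> rfl)

end Update

/-- The letter in the register. -/
def letter [Inhabited A] : Option (A ⊕ Bool) → A
  | some (.inl a) => a
  | _ => default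

/-- The bit in the register. -/
def bit : Option (A ⊕ Bool) → Bool
  | some (.inr b) => b
  | _ => false

variable [Inhabited A] (load₁ : A → T₁.Γ T₁.k₀) (load₂ : A → T₂.Γ T₂.k₀) (neg : T₂.Γ T₂.k₁ → Bool)

/-- The program. It reads a word `x` and a precision, which it forgets, hands `x` to both machines
and runs them one after the other. Then it increments a binary counter once and once more for each
symbol in the output of the first machine, and writes the counter as a rational number with
denominator `1` whose sign is given by the output of the second machine. -/
def program : Label T₁ T₂ → TM2.Stmt (Sym T₁ T₂ A) (Label T₁ T₂) (Memory T₁ T₂ A)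
  | .inl .read =>
      .pop (.inr (.inr .inp)) (fun v x => (v.1, v.2.1, x)) <|
      .branch (fun v => v.2.2.isNone) (.goto fun _ => .inl .copy) <|
      .branch (fun v => v.2.2.any Sum.isLeft)
        (.push (.inr (.inr .tmp)) (fun v => letter v.2.2) <| .goto fun _ => .inl .read)
        (.goto fun _ => .inl .read)
  | .inl .copy =>
      .pop (.inr (.inr .tmp)) (fun v x => (v.1, v.2.1, x.map Sum.inl)) <|
      .branch (fun v => v.2.2.isNone) (.goto fun _ => .inr (.inl T₁.main)) <|
      .push (.inl T₁.k₀) (fun v => load₁ (letter v.2.2)) <|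
      .push (.inr (.inl T₂.k₀)) (fun v => load₂ (letter v.2.2)) <|
      .goto fun _ => .inl .copy
  | .inl .count =>
      .pop (.inl T₁.k₁) (fun v x => (v.1, v.2.1, x.map fun _ => Sum.inr true)) <|
      .branch (fun v => v.2.2.isNone) (.goto fun _ => .inl .flip) (.goto fun _ => .inl .carry)
  | .inl .carry =>
      .pop (.inr (.inr .counter)) (fun v x => (v.1, v.2.1, x.map Sum.inr)) <|
      .branch (fun v => bit v.2.2)
        (.push (.inr (.inr .carried)) (fun _ => false) <| .goto fun _ => .inl .carry)
        (.push (.inr (.inr .counter)) (fun _ => true) <| .goto fun _ => .inl .restore)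
  | .inl .restore =>
      .pop (.inr (.inr .carried)) (fun v x => (v.1, v.2.1, x.map Sum.inr)) <|
      .branch (fun v => v.2.2.isNone) (.goto fun _ => .inl .count) <|
      .push (.inr (.inr .counter)) (fun v => bit v.2.2) <| .goto fun _ => .inl .restore
  | .inl .flip =>
      .pop (.inr (.inr .counter)) (fun v x => (v.1, v.2.1, x.map Sum.inr)) <|
      .branch (fun v => v.2.2.isNone)
        (.push (.inr (.inr .out)) (fun _ => .inr true) <| .goto fun _ => .inl .emit) <|
      .push (.inr (.inr .carried)) (fun v => bit v.2.2) <| .goto fun _ => .inl .flip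
  | .inl .emit =>
      .pop (.inr (.inr .carried)) (fun v x => (v.1, v.2.1, x.map Sum.inr)) <|
      .branch (fun v => v.2.2.isNone)
        (.pop (.inr (.inl T₂.k₁)) (fun v x => (v.1, v.2.1, x.map fun y => Sum.inr (neg y))) <|
         .push (.inr (.inr .out)) (fun v => .inl (.inl (bit v.2.2))) <|
         .load (fun v => (v.1, v.2.1, none)) .halt) <|
      .push (.inr (.inr .out)) (fun v => .inl (.inr (bit v.2.2))) <| .goto fun _ => .inl .emit
  | .inr (.inl l) =>
      embedStmt (Γ' := Sym T₁ T₂ A) .inl (memoryFst T₁ T₂ A) (fun l => .inr (.inl l))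
        (.inr (.inr T₂.main)) (T₁.m l)
  | .inr (.inr l) =>
      embedStmt (Γ' := Sym T₁ T₂ A) (fun k => .inr (.inl k)) (memorySnd T₁ T₂ A)
        (fun l => .inr (.inr l)) (.inl .carry) (T₂.m l)

section Phases

variable (s₁ : T₁.σ) (s₂ : T₂.σ)

/-- The word is moved to the stack `tmp`, which reverses it, and the precision is dropped. -/
theorem read_reaches (S₁ : ∀ k, List (T₁.Γ k)) (S₂ : ∀ k, List (T₂.Γ k)) (w : List A)
    (u : List Bool) (t : List A) (c r : List Bool) (o : List ((Bool ⊕ Bool) ⊕ Bool))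
    (g : Option (A ⊕ Bool)) :
    ReachesIn (TM2.step (program load₁ load₂ neg)) (w.length + u.length + 1)
      ⟨some (.inl .read), (s₁, s₂, g), contents S₁ S₂ (w.map .inl ++ u.map .inr) t c r o⟩
      ⟨some (.inl .copy), (s₁, s₂, none), contents S₁ S₂ [] (w.reverse ++ t) c r o⟩ := by
  induction w generalizing t g with
  | nil =>
    induction u generalizing g with
    | nil =>
      refine (ReachesIn.single ?_).mono (by simp)
      simp only [TM2.step, program, TM2.stepAux, update_inp]
      rfl
    | cons b u ih =>
      refine (ReachesIn.head ?_ (ih (some (.inr b)))).mono (by simp)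
      simp only [TM2.step, program, TM2.stepAux, update_inp]
      rfl
  | cons a w ih =>
    refine (ReachesIn.head ?_ (by simpa using ih (a :: t) (some (.inl a)))).mono (by simp)
    simp only [TM2.step, program, TM2.stepAux, update_inp, update_tmp]
    rfl

/-- The word is put on the input stacks of both machines, in its original order again. -/
theorem copy_reaches (S₁ : ∀ k, List (T₁.Γ k)) (S₂ : ∀ k, List (T₂.Γ k)) (w : List A)
    (c r : List Bool) (o : List ((Bool ⊕ Bool) ⊕ Bool)) (g : Option (A ⊕ Bool)) :
    ReachesIn (TM2.step (program load₁ load₂ neg)) (w.length + 1)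
      ⟨some (.inl .copy), (s₁, s₂, g), contents S₁ S₂ [] w c r o⟩
      ⟨some (.inr (.inl T₁.main)), (s₁, s₂, none),
        contents (Function.update S₁ T₁.k₀ (w.reverse.map load₁ ++ S₁ T₁.k₀))
          (Function.update S₂ T₂.k₀ (w.reverse.map load₂ ++ S₂ T₂.k₀)) [] [] c r o⟩ := by
  induction w generalizing S₁ S₂ g with
  | nil =>
    refine ReachesIn.single ?_
    simp only [TM2.step, program, TM2.stepAux, update_tmp]
    simp [contents]
  | cons a w ih =>
    have h := ih (Function.update S₁ T₁.k₀ (load₁ a :: S₁ T₁.k₀))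
      (Function.update S₂ T₂.k₀ (load₂ a :: S₂ T₂.k₀)) (some (.inl a))
    simp only [Function.update_idem, Function.update_self] at h
    refine ReachesIn.head ?_ (by simpa using h)
    simp only [TM2.step, program, TM2.stepAux, update_tmp, update_fst, update_snd]
    rfl

/-- The digits cleared by a carry are put back as zeros. -/
theorem restore_reaches (S₁ : ∀ k, List (T₁.Γ k)) (S₂ : ∀ k, List (T₂.Γ k)) (j : ℕ)
    (c : List Bool) (g : Option (A ⊕ Bool)) :
    ReachesIn (TM2.step (program load₁ load₂ neg)) (j + 1)
      ⟨some (.inl .restore), (s₁, s₂, g), contents S₁ S₂ [] [] c (List.replicate j false) []⟩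
      ⟨some (.inl .count), (s₁, s₂, none),
        contents S₁ S₂ [] [] (List.replicate j false ++ c) [] []⟩ := by
  induction j generalizing c g with
  | zero =>
    refine ReachesIn.single ?_
    simp only [TM2.step, program, TM2.stepAux, update_carried]
    rfl
  | succ j ih =>
    have h := ih (false :: c) (some (.inr false))
    rw [List.append_cons, ← List.replicate_succ'] at h
    refine ReachesIn.head ?_ h
    simp only [TM2.step, program, TM2.stepAux, update_carried, update_counter]
    rfl

/-- The counter is incremented, where `j` digits have been cleared by the carry already. -/
theorem carry_reaches (S₁ : ∀ k, List (T₁.Γ k)) (S₂ : ∀ k, List (T₂.Γ k)) (c : List Bool) (j : ℕ)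
    (g : Option (A ⊕ Bool)) :
    ReachesIn (TM2.step (program load₁ load₂ neg)) (2 * c.length + j + 2)
      ⟨some (.inl .carry), (s₁, s₂, g), contents S₁ S₂ [] [] c (List.replicate j false) []⟩
      ⟨some (.inl .count), (s₁, s₂, none),
        contents S₁ S₂ [] [] (List.replicate j false ++ binarySucc c) [] []⟩ := by
  induction c generalizing j g with
  | nil =>
    refine (ReachesIn.head ?_ (restore_reaches load₁ load₂ neg s₁ s₂ S₁ S₂ j [true] none)).mono
      (by simp)
    simp only [TM2.step, program, TM2.stepAux, update_counter]
    rfl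
  | cons b c ih =>
    cases b with
    | false =>
      refine (ReachesIn.head ?_ (restore_reaches load₁ load₂ neg s₁ s₂ S₁ S₂ j (true :: c)
        (some (.inr false)))).mono
        (by simp)
      simp only [TM2.step, program, TM2.stepAux, update_counter]
      rfl
    | true =>
      have h := ih (j + 1) (some (.inr true))
      rw [List.replicate_succ', List.append_assoc, ← List.replicate_succ'] at h
      refine (ReachesIn.head ?_ h).mono (by simp; omega)
      simp only [TM2.step, program, TM2.stepAux, update_counter, update_carried]
      rfl

/-- The counter is incremented once for every symbol of the output of the first machine. -/
theorem count_reaches (S₁ : ∀ k, List (T₁.Γ k)) (S₂ : ∀ k, List (T₂.Γ k))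
    (w : List (T₁.Γ T₁.k₁)) (n N : ℕ) (hN : n + w.length ≤ N) (g : Option (A ⊕ Bool)) :
    ReachesIn (TM2.step (program load₁ load₂ neg)) (w.length * (2 * N + 3) + 1)
      ⟨some (.inl .count), (s₁, s₂, g),
        contents (Function.update S₁ T₁.k₁ w) S₂ [] [] (encodeNat n) [] []⟩
      ⟨some (.inl .flip), (s₁, s₂, none),
        contents (Function.update S₁ T₁.k₁ []) S₂ [] [] (encodeNat (n + w.length)) [] []⟩ := by
  induction w generalizing n g with
  | nil =>
    refine (ReachesIn.single ?_).mono (by simp)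
    simp only [TM2.step, program, TM2.stepAux, update_fst]
    simp [contents]
  | cons a w ih =>
    have h := carry_reaches load₁ load₂ neg s₁ s₂
      (Function.update S₁ T₁.k₁ w) S₂ (encodeNat n) 0 (some (.inr true))
    rw [List.replicate_zero, List.nil_append, ← encodeNat_succ] at h
    rw [List.length_cons] at hN
    have h' := h.trans (ih (n + 1) (by omega) none)
    rw [List.length_cons, show n + (w.length + 1) = n + 1 + w.length by omega]
    refine (ReachesIn.head ?_ h').mono ?_
    · simp only [TM2.step, program, TM2.stepAux, update_fst]
      simp [contents]
    -- A carry passes over at most as many digits as the counter has, at most `n`.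
    · have := length_encodeNat_le n
      rw [Nat.add_mul]
      omega

/-- The denominator `1` is written, and the counter is reversed, so that `emit` puts its digits on
the output stack in the right order. -/
theorem flip_reaches (S₁ : ∀ k, List (T₁.Γ k)) (S₂ : ∀ k, List (T₂.Γ k)) (c r : List Bool)
    (g : Option (A ⊕ Bool)) :
    ReachesIn (TM2.step (program load₁ load₂ neg)) (c.length + 1)
      ⟨some (.inl .flip), (s₁, s₂, g), contents S₁ S₂ [] [] c r []⟩
      ⟨some (.inl .emit), (s₁, s₂, none),
        contents S₁ S₂ [] [] [] (c.reverse ++ r) [.inr true]⟩ := by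
  induction c generalizing r g with
  | nil =>
    refine ReachesIn.single ?_
    simp only [TM2.step, program, TM2.stepAux, update_counter, update_out]
    rfl
  | cons b c ih =>
    refine ReachesIn.head ?_ (by simpa using ih (b :: r) (some (.inr b)))
    simp only [TM2.step, program, TM2.stepAux, update_counter, update_carried]
    rfl

/-- The digits of the counter and then the sign are written, and the memory is cleared. -/
theorem emit_reaches (S₁ : ∀ k, List (T₁.Γ k)) (S₂ : ∀ k, List (T₂.Γ k)) {y : T₂.Γ T₂.k₁}
    (hy : S₂ T₂.k₁ = [y]) (r : List Bool) (o : List ((Bool ⊕ Bool) ⊕ Bool)) (g : Option (A ⊕ Bool)) :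
    ReachesIn (TM2.step (program load₁ load₂ neg)) (r.length + 1)
      ⟨some (.inl .emit), (s₁, s₂, g), contents S₁ S₂ [] [] [] r o⟩
      ⟨none, (s₁, s₂, none), contents S₁ (Function.update S₂ T₂.k₁ []) [] [] [] []
        (.inl (.inl (neg y)) :: (r.reverse.map fun b => .inl (.inr b)) ++ o)⟩ := by
  induction r generalizing o g with
  | nil =>
    refine ReachesIn.single ?_
    simp only [TM2.step, program, TM2.stepAux, update_carried]
    simp [contents, hy, update_snd, update_out, bit]
  | cons b r ih =>
    refine ReachesIn.head ?_ (by simpa using ih (.inl (.inr b) :: o) (some (.inr b)))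
    simp only [TM2.step, program, TM2.stepAux, update_carried, update_out]
    rfl

end Phases

theorem initList_eq (T : FinTM2) (s : List (T.Γ T.k₀)) :
    initList T s = ⟨some T.main, T.initialState, Function.update (fun _ => []) T.k₀ s⟩ := by
  refine congrArg (TM2.Cfg.mk _ _) (funext fun k => ?_)
  by_cases h : k = T.k₀
  · subst h; simp
  · rw [Function.update_of_ne h, dif_neg h]

theorem haltList_eq (T : FinTM2) (s : List (T.Γ T.k₁)) :
    haltList T s = ⟨none, T.initialState, Function.update (fun _ => []) T.k₁ s⟩ := by
  refine congrArg (TM2.Cfg.mk _ _) (funext fun k => ?_)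
  by_cases h : k = T.k₁
  · subst h; simp
  · rw [Function.update_of_ne h, dif_neg h]

variable {T₁ T₂ : FinTM2} {A : Type} [Inhabited A] {load₁ : A → T₁.Γ T₁.k₀}
  {load₂ : A → T₂.Γ T₂.k₀} {neg : T₂.Γ T₂.k₁ → Bool}

/-- The first machine runs from its initial to its halting configuration, in which all its stacks
but the output stack are empty. -/
theorem run_fst_reaches {x : List (T₁.Γ T₁.k₀)} {y : List (T₁.Γ T₁.k₁)} {n : ℕ}
    (h : TM2OutputsInTime T₁ x (some y) n) (S₂ : ∀ k, List (T₂.Γ k)) (s₂ : T₂.σ) :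
    ReachesIn (TM2.step (program load₁ load₂ neg)) n
      ⟨some (.inr (.inl T₁.main)), (T₁.initialState, s₂, none),
        contents (Function.update (fun _ => []) T₁.k₀ x) S₂ [] [] [] [] []⟩
      ⟨some (.inr (.inr T₂.main)), (T₁.initialState, s₂, none),
        contents (Function.update (fun _ => []) T₁.k₁ y) S₂ [] [] [] [] []⟩ := by
  obtain ⟨⟨m, hm⟩, hmn⟩ := h
  rw [Option.map_some, initList_eq, haltList_eq] at hm
  obtain ⟨⟨l, v, S⟩, hd, h₁, h₂, h₃, h₄⟩ := shows_iterate (Γ' := Sym T₁ T₂ A) (ι := Sum.inl)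
    (e := memoryFst T₁ T₂ A) (lab := fun l => .inr (.inl l)) (exit := .inr (.inr T₂.main))
    (r := (s₂, none)) (F := contents (fun _ => []) S₂ [] [] [] [] [])
    Sum.inl_injective (M := T₁.m) (M' := program load₁ load₂ neg) (fun _ => rfl) m hm
    (c' := ⟨some (.inr (.inl T₁.main)), (T₁.initialState, s₂, none),
        contents (Function.update (fun _ => []) T₁.k₀ x) S₂ [] [] [] [] []⟩)
    ⟨rfl, rfl, fun _ => rfl, by
      rintro (k | k | k) hk
      exacts [absurd ⟨k, rfl⟩ hk, rfl, by cases k <;> rfl]⟩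
  obtain rfl : v = (T₁.initialState, s₂, none) := h₂
  obtain rfl : l = some (.inr (.inr T₂.main)) := h₁
  obtain rfl : S = contents (Function.update (fun _ => []) T₁.k₁ y) S₂ [] [] [] [] [] := by
    funext k
    rcases k with k | k | k
    · exact h₃ k
    · exact h₄ _ (by simp)
    · exact (h₄ (.inr (.inr k)) (by simp)).trans (by cases k <;> rfl)
  exact hd.mono hmn

/-- The second machine runs while the output of the first one is kept. -/
theorem run_snd_reaches {x : List (T₂.Γ T₂.k₀)} {y : List (T₂.Γ T₂.k₁)} {n : ℕ}
    (h : TM2OutputsInTime T₂ x (some y) n) (S₁ : ∀ k, List (T₁.Γ k)) (s₁ : T₁.σ) :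
    ReachesIn (TM2.step (program load₁ load₂ neg)) n
      ⟨some (.inr (.inr T₂.main)), (s₁, T₂.initialState, none),
        contents S₁ (Function.update (fun _ => []) T₂.k₀ x) [] [] [] [] []⟩
      ⟨some (.inl .carry), (s₁, T₂.initialState, none),
        contents S₁ (Function.update (fun _ => []) T₂.k₁ y) [] [] [] [] []⟩ := by
  obtain ⟨⟨m, hm⟩, hmn⟩ := h
  rw [Option.map_some, initList_eq, haltList_eq] at hm
  obtain ⟨⟨l, v, S⟩, hd, h₁, h₂, h₃, h₄⟩ := shows_iterate (Γ' := Sym T₁ T₂ A)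
    (ι := fun k => .inr (.inl k)) (e := memorySnd T₁ T₂ A) (lab := fun l => .inr (.inr l))
    (exit := .inl .carry) (r := (s₁, none)) (F := contents S₁ (fun _ => []) [] [] [] [] [])
    (Sum.inr_injective.comp Sum.inl_injective) (M := T₂.m) (M' := program load₁ load₂ neg)
    (fun _ => rfl) m hm
    (c' := ⟨some (.inr (.inr T₂.main)), (s₁, T₂.initialState, none),
        contents S₁ (Function.update (fun _ => []) T₂.k₀ x) [] [] [] [] []⟩)
    ⟨rfl, rfl, fun _ => rfl, by
      rintro (k | k | k) hk
      exacts [rfl, absurd ⟨k, rfl⟩ hk, by cases k <;> rfl]⟩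
  obtain rfl : v = (s₁, T₂.initialState, none) := (memorySnd T₁ T₂ A).injective h₂
  obtain rfl : l = some (.inl .carry) := h₁
  obtain rfl : S = contents S₁ (Function.update (fun _ => []) T₂.k₁ y) [] [] [] [] [] := by
    funext k
    rcases k with k | k | k
    · exact h₄ (.inl k) (by simp)
    · exact h₃ k
    · exact (h₄ (.inr (.inr k)) (by simp)).trans (by cases k <;> rfl)
  exact hd.mono hmn

/-- The length of the output is bounded linearly in the input length and the running time. -/
theorem exists_output_length_le (T : FinTM2) : ∃ C : ℕ, ∀ (x : List (T.Γ T.k₀))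
    (y : List (T.Γ T.k₁)) (n : ℕ), TM2OutputsInTime T x (some y) n →
    y.length ≤ x.length + C * n := by
  let := T.ΛFin
  refine ⟨∑ l, pushCount (T.m l), fun x y n ⟨⟨m, hm⟩, hmn⟩ => ?_⟩
  rw [Option.map_some, initList_eq, haltList_eq] at hm
  have h := length_stk_iterate_le (M := T.m) (fun l => Finset.single_le_sum
    (f := fun l => pushCount (T.m l)) (fun _ _ => Nat.zero_le _) (Finset.mem_univ l)) m hm T.k₁
  -- Input and output stack may coincide, so that a part of the input may be left in the output.
  have h₁ : (Function.update (fun _ => []) T.k₀ x T.k₁ : List (T.Γ T.k₁)).length ≤ x.length := by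
    generalize T.k₁ = k
    by_cases hk : k = T.k₀
    · subst hk; simp
    · rw [Function.update_of_ne hk]; simp
  dsimp only at h
  rw [Function.update_self] at h
  have := Nat.mul_le_mul_left (∑ l, pushCount (T.m l)) (show m ≤ n from hmn)
  omega

theorem program_reaches {x : List A} (u : List Bool) {y : List (T₁.Γ T₁.k₁)} {z : T₂.Γ T₂.k₁}
    {n₁ n₂ : ℕ} (h₁ : TM2OutputsInTime T₁ (x.map load₁) (some y) n₁)
    (h₂ : TM2OutputsInTime T₂ (x.map load₂) (some [z]) n₂) :
    ReachesIn (TM2.step (program load₁ load₂ neg))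
      (2 * (x.length + u.length) + n₁ + n₂ + y.length * (2 * y.length + 7) + 9)
      ⟨some (.inl .read), (T₁.initialState, T₂.initialState, none),
        contents (fun _ => []) (fun _ => []) (x.map .inl ++ u.map .inr) [] [] [] []⟩
      ⟨none, (T₁.initialState, T₂.initialState, none),
        contents (fun _ => []) (fun _ => []) [] [] [] [] (.inl (.inl (neg z)) ::
          ((encodeNat (y.length + 1)).map fun b => .inl (.inr b)) ++ [.inr true])⟩ := by
  have e₁ := read_reaches load₁ load₂ neg T₁.initialState T₂.initialState
    (fun _ => []) (fun _ => []) x u [] [] [] [] none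
  have e₂ := copy_reaches load₁ load₂ neg T₁.initialState T₂.initialState
    (fun _ => []) (fun _ => []) x.reverse [] [] [] none
  simp only [List.append_nil, List.reverse_reverse, List.length_reverse] at e₁ e₂
  have e₃ := run_fst_reaches (load₁ := load₁) (load₂ := load₂) (neg := neg) h₁
    (Function.update (fun _ => []) T₂.k₀ (x.map load₂)) T₂.initialState
  have e₄ := run_snd_reaches (load₁ := load₁) (load₂ := load₂) (neg := neg) h₂
    (Function.update (fun _ => []) T₁.k₁ y) T₁.initialState
  have e₅ := carry_reaches load₁ load₂ neg T₁.initialState T₂.initialState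
    (Function.update (fun _ => []) T₁.k₁ y) (Function.update (fun _ => []) T₂.k₁ [z]) (encodeNat 0) 0 none
  rw [List.replicate_zero, List.nil_append, ← encodeNat_succ] at e₅
  have e₆ := count_reaches load₁ load₂ neg T₁.initialState T₂.initialState
    (fun _ => []) (Function.update (fun _ => []) T₂.k₁ [z]) y 1
    (y.length + 1) (by omega) none
  have e₇ := flip_reaches load₁ load₂ neg T₁.initialState T₂.initialState
    (fun _ => []) (Function.update (fun _ => []) T₂.k₁ [z])
    (encodeNat (1 + y.length)) [] none
  have e₈ := emit_reaches load₁ load₂ neg T₁.initialState T₂.initialState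
    (fun _ => []) (S₂ := Function.update (fun _ => []) T₂.k₁ [z])
    (Function.update_self ..) (encodeNat (1 + y.length)).reverse [.inr true] none
  simp only [List.append_nil, List.reverse_reverse, List.length_reverse, Function.update_idem,
    Nat.add_comm 1] at e₆ e₇ e₈
  rw [Function.update_eq_self T₁.k₁ fun _ => []] at e₆
  rw [Function.update_eq_self T₂.k₁ fun _ => []] at e₈
  have h₀ : encodeNat 0 = [] := rfl
  rw [h₀] at e₅
  refine (e₁.trans <| e₂.trans <| e₃.trans <| e₄.trans <| e₅.trans <| e₆.trans <|
    e₇.trans e₈).mono ?_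
  have := length_encodeNat_le (y.length + 1)
  simp only [List.length_nil]
  nlinarith

/-- The signed length machine. -/
def machine [Fintype A] (load₁ : A → T₁.Γ T₁.k₀) (load₂ : A → T₂.Γ T₂.k₀)
    (neg : T₂.Γ T₂.k₁ → Bool) : FinTM2 :=
  letI := T₁.kFin
  letI := T₂.kFin
  letI := T₁.ΛFin
  letI := T₂.ΛFin
  letI := T₁.σFin
  letI := T₂.σFin
  { K := T₁.K ⊕ T₂.K ⊕ AuxStack
    k₀ := .inr (.inr .inp)
    k₁ := .inr (.inr .out)
    Γ := Sym T₁ T₂ A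
    Λ := Label T₁ T₂
    main := .inl .read
    σ := Memory T₁ T₂ A
    initialState := (T₁.initialState, T₂.initialState, none)
    Γk₀Fin := inferInstanceAs (Fintype (A ⊕ Bool))
    m := program load₁ load₂ neg }

theorem initList_machine [Fintype A] (i : List (A ⊕ Bool)) :
    initList (machine load₁ load₂ neg) i =
      ⟨some (.inl .read), (T₁.initialState, T₂.initialState, none),
        contents (fun _ => []) (fun _ => []) i [] [] [] []⟩ := by
  refine (initList_eq _ _).trans (congrArg (TM2.Cfg.mk _ _) (funext fun k => ?_))
  rcases k with k | k | k
  · rfl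
  · rfl
  · cases k <;> rfl

theorem haltList_machine [Fintype A] (o : List ((Bool ⊕ Bool) ⊕ Bool)) :
    haltList (machine load₁ load₂ neg) o =
      ⟨none, (T₁.initialState, T₂.initialState, none),
        contents (fun _ => []) (fun _ => []) [] [] [] [] o⟩ := by
  refine (haltList_eq _ _).trans (congrArg (TM2.Cfg.mk _ _) (funext fun k => ?_))
  rcases k with k | k | k
  · rfl
  · rfl
  · cases k <;> rfl

end SignedLength

theorem eval_le_eval_of_le (p : Polynomial ℕ) {m n : ℕ} (h : m ≤ n) : p.eval m ≤ p.eval n := by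
  simp only [Polynomial.eval_eq_sum_range]
  gcongr

/-- The length of `f x` plus one, with a sign that tells whether `neg` holds at `g x`. (As the
length is shifted, the sign is also seen where `f x` is empty.) -/
def signedLength {A B C : Type} (f : List A → List B) (g : List A → C) (neg : C → Bool)
    (x : List A) : ℤ :=
  if neg (g x) then -((f x).length + 1 : ℕ) else ((f x).length + 1 : ℕ)

theorem ratCode_signedLength {A B C : Type} (f : List A → List B) (g : List A → C)
    (neg : C → Bool) (x : List A) :
    ratCode (signedLength f g neg x) = .inl (.inl (neg (g x))) ::
      ((encodeNat ((f x).length + 1)).map fun b => .inl (.inr b)) ++ [.inr true] := by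
  have key : ∀ (z : ℤ) (b : Bool) (n : ℕ), decide (z < 0) = b → z.natAbs = n →
      ratCode z = .inl (.inl b) :: ((encodeNat n).map fun b => .inl (.inr b)) ++ [.inr true] := by
    rintro z _ _ rfl rfl
    simp [ratCode, encodingProd, encodingBoolBool, encodingNatBool, encodeBool, encodeNat_one]
  apply key <;> rw [signedLength]
  · cases neg (g x)
    · simp only [Bool.false_eq_true, if_false, decide_eq_false_iff_not]; omega
    · simp only [if_true, decide_eq_true_eq]; omega
  · split_ifs <;> simp only [Int.natAbs_neg, Int.natAbs_natCast]

theorem isPolyTime_signedLength {A B C : Type} [Fintype A] [Nonempty A] {f : List A → List B}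
    {g : List A → C} (neg : C → Bool)
    (hf : IsPolyTime (encodingList A).encode (encodingList B).encode f)
    (hg : IsPolyTime (encodingList A).encode (fun v => [v]) g) :
    IsPolyTime (encodingProd (encodingList A) unaryEncodingNat).encode ratCode
      (fun p : List A × ℕ => (signedLength f g neg p.1 : ℚ)) := by
  obtain ⟨h₁⟩ := hf
  obtain ⟨h₂⟩ := hg
  obtain ⟨C, hC⟩ := SignedLength.exists_output_length_le h₁.tm
  inhabit A
  let N : Polynomial ℕ := .X + .C C * h₁.time
  refine ⟨⟨⟨SignedLength.machine h₁.inputAlphabet.symm h₂.inputAlphabet.symm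
    (fun y => neg (h₂.outputAlphabet y)), Equiv.refl (A ⊕ Bool),
    Equiv.refl ((Bool ⊕ Bool) ⊕ Bool)⟩,
    2 * .X + h₁.time + h₂.time + N * (2 * N + 7) + 9, fun p => Classical.choice ?_⟩⟩
  obtain ⟨x, k⟩ := p
  have r₁ := h₁.outputsFun x
  have r₂ := h₂.outputsFun x
  have hlen := hC _ _ _ r₁
  obtain ⟨m, hm, e⟩ := SignedLength.program_reaches (neg := fun y => neg (h₂.outputAlphabet y))
    (unaryEncodeNat k) r₁ r₂
  have e₁ : ((encodingProd (encodingList A) unaryEncodingNat).encode (x, k)) =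
      x.map .inl ++ (unaryEncodeNat k).map .inr := rfl
  refine ⟨⟨⟨m, ?_⟩, hm.trans ?_⟩⟩
  · refine (congrArg (fun c => (flip Bind.bind (TM2.step (SignedLength.program
      h₁.inputAlphabet.symm h₂.inputAlphabet.symm fun y => neg (h₂.outputAlphabet y))))^[m]
      (some c)) ?_).trans (e.trans (congrArg some ?_))
    · refine (SignedLength.initList_machine _).trans ?_
      congr 2
      exact List.map_id _
    · refine Eq.trans ?_ (SignedLength.haltList_machine _).symm
      congr 2
      refine Eq.trans ?_ (List.map_id _).symm
      refine Eq.trans ?_ (ratCode_signedLength f g neg x).symm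
      simp [encodingList]
  · rw [List.length_map, List.length_map] at hlen
    rw [List.length_map, e₁, List.length_append, List.length_map, List.length_map]
    simp only [Polynomial.eval_add, Polynomial.eval_mul, Polynomial.eval_ofNat, Polynomial.eval_X,
      Polynomial.eval_C, N]
    have hx : x.length ≤ x.length + (unaryEncodeNat k).length := Nat.le_add_right _ _
    have t₁ := eval_le_eval_of_le h₁.time hx
    have t₂ := eval_le_eval_of_le h₂.time hx
    have hy : (f x).length ≤ x.length + (unaryEncodeNat k).length +
        C * h₁.time.eval (x.length + (unaryEncodeNat k).length) :=
      hlen.trans (add_le_add hx (Nat.mul_le_mul_left C t₁))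
    simp only [encodingList, id]
    gcongr

/-! ### Counting words -/

section Counting

variable {A : Type} [Fintype A] (φ : List A ≃ List A)

theorem finite_sizeClass (n : ℕ) : (sizeClass φ n).Finite :=
  (List.finite_length_eq A n).preimage φ.injective.injOn

theorem ncard_sizeClass (n : ℕ) : (sizeClass φ n).ncard = Fintype.card A ^ n := by
  have h : sizeClass φ n = φ ⁻¹' {w | w.length = n} := rfl
  rw [h, Set.ncard_preimage_of_injective_subset_range φ.injective
    (by rw [φ.surjective.range_eq]; exact Set.subset_univ _), ← card_vector n,
    ← Nat.card_eq_fintype_card]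
  rfl

theorem finite_length_le (N : ℕ) : {x | (φ x).length ≤ N}.Finite :=
  (List.finite_length_le A N).preimage φ.injective.injOn

theorem ncard_length_le [Nonempty A] (N : ℕ) :
    {x | (φ x).length ≤ N}.ncard ≤ (2 * Fintype.card A) ^ N := by
  have hk : 1 ≤ Fintype.card A := Fintype.card_pos
  induction N with
  | zero =>
    have h : {x | (φ x).length ≤ 0} = sizeClass φ 0 := by ext x; simp [sizeClass]
    rw [h, ncard_sizeClass, pow_zero, pow_zero]
  | succ N ih =>
    have h : {x | (φ x).length ≤ N + 1} = {x | (φ x).length ≤ N} ∪ sizeClass φ (N + 1) := by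
      ext x; simp only [sizeClass, Set.mem_ofPred_eq, Set.mem_union]; omega
    have hpow : Fintype.card A ^ N ≤ (2 * Fintype.card A) ^ N := Nat.pow_le_pow_left (by omega) N
    rw [h]
    refine (Set.ncard_union_le _ _).trans ?_
    rw [ncard_sizeClass, pow_succ, pow_succ]
    nlinarith [Nat.mul_le_mul_right (Fintype.card A) hpow,
      Nat.mul_le_mul_left ((2 * Fintype.card A) ^ N) hk]

theorem mul_le_ncard_of_le_fractionOf {b : ℝ} {n : ℕ} {T : Set (List A)}
    (h : b ≤ fractionOf (sizeClass φ n) T) (hA : 0 < Fintype.card A) :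
    b * (Fintype.card A : ℝ) ^ n ≤ ((sizeClass φ n ∩ T).ncard : ℝ) := by
  rw [fractionOf, ncard_sizeClass, Nat.cast_pow] at h
  rwa [← le_div_iff₀ (by positivity)]

theorem ncard_le_mul_of_fractionOf_le {b : ℝ} {n : ℕ} {T : Set (List A)}
    (h : fractionOf (sizeClass φ n) T ≤ b) (hA : 0 < Fintype.card A) :
    ((sizeClass φ n ∩ T).ncard : ℝ) ≤ b * (Fintype.card A : ℝ) ^ n := by
  rw [fractionOf, ncard_sizeClass, Nat.cast_pow] at h
  rwa [← div_le_iff₀ (by positivity)]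

end Counting

/-! ### Fractions -/

theorem acceptingFraction_nonneg {A : Type} (L : Language A) (S : Set (List A)) :
    0 ≤ acceptingFraction L S := by
  unfold acceptingFraction fractionOf; positivity

theorem acceptingFraction_le_one {A : Type} (L : Language A) {S : Set (List A)} (hS : S.Finite) :
    acceptingFraction L S ≤ 1 := by
  unfold acceptingFraction fractionOf
  exact div_le_one_of_le₀ (by exact_mod_cast Set.ncard_le_ncard Set.inter_subset_left hS)
    (by positivity)

theorem one_sub_div_le_acceptingFraction {A : Type} (L : Language A) {S : Set (List A)}
    (hS : S.Finite) {u v : ℝ} (hv : 0 < v) (hu : ((S \ {x | x ∈ L}).ncard : ℝ) ≤ u)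
    (hSv : v ≤ (S.ncard : ℝ)) : 1 - u / v ≤ acceptingFraction L S := by
  have h := Set.ncard_inter_add_ncard_sdiff_eq_ncard S {x | x ∈ L} hS
  have h' : ((S ∩ {x | x ∈ L}).ncard : ℝ) = S.ncard - (S \ {x | x ∈ L}).ncard := by
    rw [← h]; push_cast; ring
  have hpos : (0 : ℝ) < S.ncard := hv.trans_le hSv
  rw [acceptingFraction, fractionOf, h', sub_div, div_self hpos.ne']
  have hu0 : 0 ≤ u := le_trans (by positivity) hu
  gcongr

/-! ### Vanishing sequences -/

theorem tendsto_eval_mul_pow (p : Polynomial ℝ) {c : ℝ} (h₀ : 0 ≤ c) (h₁ : c < 1) :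
    Tendsto (fun n : ℕ => p.eval (n : ℝ) * c ^ n) atTop (𝓝 0) := by
  simp only [Polynomial.eval_eq_sum_range, Finset.sum_mul, mul_assoc]
  rw [← Finset.sum_const_zero (s := Finset.range (p.natDegree + 1))]
  refine tendsto_finsetSum _ fun i _ => ?_
  simpa using (tendsto_pow_const_mul_const_pow_of_abs_lt_one i
    (by rwa [abs_of_nonneg h₀])).const_mul (p.coeff i)

/-- A vanishing sequence has a nonincreasing vanishing majorant on the real line. -/
theorem exists_antitone_majorant {e : ℕ → ℝ} (he : Tendsto e atTop (𝓝 0)) (h₀ : ∀ n, 0 ≤ e n) :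
    ∃ h : ℝ → ℝ, Antitone h ∧ Tendsto h atTop (𝓝 0) ∧
      ∀ (n : ℕ) (t : ℝ), t ≤ n + 1 → e n ≤ h t := by
  obtain ⟨B, hB⟩ := he.bddAbove_range
  have hB' : ∀ n, e n ≤ B := fun n => hB ⟨n, rfl⟩
  have hbdd : ∀ t : ℝ, BddAbove (Set.range fun n : ℕ => if t ≤ n + 1 then e n else 0) := by
    refine fun t => ⟨B, ?_⟩
    rintro _ ⟨n, rfl⟩
    dsimp only
    split_ifs
    exacts [hB' n, (h₀ n).trans (hB' n)]
  refine ⟨fun t => ⨆ n : ℕ, if t ≤ n + 1 then e n else 0, fun s t hst => ?_, ?_, fun n t ht => ?_⟩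
  · refine ciSup_mono (hbdd s) fun n => ?_
    split_ifs with h₁ h₂ h₂
    exacts [le_rfl, absurd (hst.trans h₁) h₂, h₀ n, le_rfl]
  · rw [Metric.tendsto_atTop]
    intro ε hε
    obtain ⟨N, hN⟩ := Metric.tendsto_atTop.1 he (ε / 2) (half_pos hε)
    refine ⟨N + 2, fun t ht => ?_⟩
    have hle : (⨆ n : ℕ, if t ≤ n + 1 then e n else 0) ≤ ε / 2 := by
      refine ciSup_le fun n => ?_
      split_ifs with h
      · have hn : N ≤ n := by
          have : (N : ℝ) ≤ n := by linarith
          exact_mod_cast this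
        have := hN n hn
        rw [Real.dist_eq, sub_zero] at this
        exact (le_abs_self _).trans this.le
      · positivity
    have hge : 0 ≤ ⨆ n : ℕ, if t ≤ n + 1 then e n else 0 := by
      refine Real.iSup_nonneg fun n => ?_
      split_ifs
      exacts [h₀ n, le_rfl]
    rw [Real.dist_eq, sub_zero, abs_of_nonneg hge]
    linarith
  · have := le_ciSup (hbdd t) n
    rwa [if_pos ht] at this

/-! ### The signed length as a parameter -/

section SignedLengthParameter

/-- Whether a verdict is a rejection. -/
def Verdict.isReject : Verdict → Bool
  | .reject => true
  | _ => false

/-- The signed length of `φ x` for the sign that the heuristic `P` gives: rejected words get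
negative values, all others positive ones. -/
def verdictParameter {A : Type} (φ : List A ≃ List A) (P : List A → Verdict) (x : List A) : ℝ :=
  signedLength φ P Verdict.isReject x

variable {A : Type} {φ : List A ≃ List A} {P : List A → Verdict} {x : List A}

theorem isParameter_verdictParameter [Fintype A] [Nonempty A] (hφ : IsPolyTimeWordMap φ)
    (hP : IsPolyTime (encodingList A).encode (fun v : Verdict => [v]) P) :
    IsParameter (verdictParameter φ P) :=
  ⟨_, isPolyTime_signedLength Verdict.isReject hφ hP, fun x k => by simp [verdictParameter]⟩

theorem verdictParameter_of_reject (h : P x = .reject) :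
    verdictParameter φ P x = -((φ x).length + 1) := by
  simp [verdictParameter, signedLength, h, Verdict.isReject]

theorem verdictParameter_of_ne_reject (h : P x ≠ .reject) :
    verdictParameter φ P x = (φ x).length + 1 := by
  rw [verdictParameter, signedLength]
  cases hx : P x <;> simp_all [Verdict.isReject]

theorem abs_verdictParameter (x : List A) : |verdictParameter φ P x| = (φ x).length + 1 := by
  by_cases h : P x = .reject
  · rw [verdictParameter_of_reject h, abs_neg, abs_of_pos (by positivity)]
  · rw [verdictParameter_of_ne_reject h, abs_of_pos (by positivity)]

theorem reject_of_verdictParameter_neg (h : verdictParameter φ P x < 0) : P x = .reject := by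
  by_contra hx
  rw [verdictParameter_of_ne_reject hx] at h
  exact absurd h (not_lt.2 (by positivity))

/-- The positive slices: the words of a size class that are accepted or undecided. -/
theorem parameterSlice_add_one (φ : List A ≃ List A) (P : List A → Verdict) (n : ℕ) :
    parameterSlice (verdictParameter φ P) (n + 1) = sizeClass φ n ∩ {x | P x ≠ .reject} := by
  ext x
  simp only [parameterSlice, sizeClass, Set.mem_inter_iff, Set.mem_ofPred_eq]
  by_cases h : P x = .reject
  · rw [verdictParameter_of_reject h]
    refine iff_of_false (fun hx => ?_) (fun hx => hx.2 h)
    have : (0 : ℝ) ≤ (φ x).length := by positivity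
    have : (0 : ℝ) ≤ n := by positivity
    linarith
  · rw [verdictParameter_of_ne_reject h]
    simp [h]

/-- The negative slices: the rejected words of a size class. -/
theorem parameterSlice_neg_add_one (φ : List A ≃ List A) (P : List A → Verdict) (n : ℕ) :
    parameterSlice (verdictParameter φ P) (-(n + 1)) = sizeClass φ n ∩ {x | P x = .reject} := by
  ext x
  simp only [parameterSlice, sizeClass, Set.mem_inter_iff, Set.mem_ofPred_eq]
  by_cases h : P x = .reject
  · rw [verdictParameter_of_reject h, neg_inj]
    simp [h]
  · rw [verdictParameter_of_ne_reject h]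
    refine iff_of_false (fun hx => ?_) (fun hx => h hx.2)
    have : (0 : ℝ) ≤ (φ x).length := by positivity
    have : (0 : ℝ) ≤ n := by positivity
    linarith

theorem finite_parameterSlice [Fintype A] (φ : List A ≃ List A) (P : List A → Verdict) (t : ℝ) :
    (parameterSlice (verdictParameter φ P) t).Finite := by
  refine (finite_length_le φ ⌊|t|⌋₊).subset fun x hx => Nat.le_floor ?_
  rw [← show verdictParameter φ P x = t from hx, abs_verdictParameter]
  linarith

end SignedLengthParameter

/-! ### The phase transition -/

section PhaseTransition

variable {A : Type} {L : Language A} {φ : List A ≃ List A} {P : List A → Verdict}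
  {p : Polynomial ℝ}

theorem acceptingFraction_parameterSlice_of_neg (hrej : ∀ x, P x = .reject → x ∉ L) {t : ℝ}
    (ht : t < 0) : acceptingFraction L (parameterSlice (verdictParameter φ P) t) = 0 := by
  have h : parameterSlice (verdictParameter φ P) t ∩ {x | x ∈ L} = ∅ := by
    refine Set.eq_empty_of_forall_notMem fun x hx => hrej x ?_ hx.2
    exact reject_of_verdictParameter_neg (φ := φ)
      ((show verdictParameter φ P x = t from hx.1).trans_lt ht)
  rw [acceptingFraction, fractionOf, h, Set.ncard_empty, Nat.cast_zero, zero_div]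

variable [Fintype A]

/-- Each slice holds the correctly accepted or the correctly rejected words of a size class. -/
theorem le_ncard_parameterSlice (hA : 0 < Fintype.card A) (hp : IsBalancedBy L φ P p) {n : ℕ}
    (hn : 1 ≤ n) {t : ℝ} (ht : |t| = n + 1) :
    (p.eval (n : ℝ))⁻¹ * (Fintype.card A : ℝ) ^ n ≤
      ((parameterSlice (verdictParameter φ P) t).ncard : ℝ) := by
  obtain ⟨-, hacc, hrej⟩ := hp.1 n hn
  rcases (abs_eq (by positivity)).1 ht with rfl | rfl
  · refine (mul_le_ncard_of_le_fractionOf φ hacc hA).trans ?_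
    rw [parameterSlice_add_one]
    refine Nat.cast_le.2 (Set.ncard_le_ncard (Set.inter_subset_inter_right _ fun x hx h => ?_)
      ((finite_sizeClass φ n).inter_of_left _))
    exact Verdict.noConfusion (hx.1.symm.trans h)
  · refine (mul_le_ncard_of_le_fractionOf φ hrej hA).trans ?_
    rw [parameterSlice_neg_add_one]
    exact Nat.cast_le.2 (Set.ncard_le_ncard (Set.inter_subset_inter_right _ fun x hx => hx.1)
      ((finite_sizeClass φ n).inter_of_left _))

theorem growsExponentiallyFrom_verdictParameter (hA : 2 ≤ Fintype.card A)
    (hp : IsBalancedBy L φ P p) : GrowsExponentiallyFrom (verdictParameter φ P) 0 := by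
  have : Nonempty A := Fintype.card_pos_iff.1 (by omega)
  have hA' : (2 : ℝ) ≤ Fintype.card A := by exact_mod_cast hA
  have hp1 : 0 < p.eval ((1 : ℕ) : ℝ) := (hp.1 1 le_rfl).1
  -- `D` is the value at `1` of the nonincreasing function `p n * (1 / √2) ^ n`.
  set D : ℝ := p.eval ((1 : ℕ) : ℝ) * (1 / √2) ^ 1 with hD
  have hD0 : 0 < D := by positivity
  have key : ∀ n : ℕ, 1 ≤ n → √2 ^ n / D ≤ (p.eval (n : ℝ))⁻¹ * (Fintype.card A : ℝ) ^ n := by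
    intro n hn
    have hpn := (hp.1 n hn).1
    have h : p.eval (n : ℝ) * (1 / √2) ^ n ≤ D := hp.2 (Set.mem_Ici.2 le_rfl) (Set.mem_Ici.2 hn) hn
    rw [one_div, inv_pow, ← div_eq_mul_inv, div_le_iff₀ (by positivity)] at h
    have h2 : √2 ^ n * √2 ^ n = (2 : ℝ) ^ n := by
      rw [← mul_pow, Real.mul_self_sqrt (by norm_num)]
    have h3 : (2 : ℝ) ^ n ≤ (Fintype.card A : ℝ) ^ n := by gcongr
    rw [inv_mul_eq_div, div_le_div_iff₀ hD0 hpn]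
    have h4 : (0 : ℝ) < √2 ^ n := by positivity
    nlinarith
  -- Slices at all integers but `0` and `±1` are seen to be nonempty, and a window of width `1`
  -- contains an integer.
  refine ⟨⟨1, 3, one_pos, fun a ha => ?_⟩, fun δ hδ => ?_⟩
  · rw [sub_zero] at ha
    have h₁ := Int.le_ceil a
    have h₂ := Int.ceil_lt_add_one a
    have hm : 2 ≤ |⌈a⌉| := by
      have : (1 : ℝ) < |(⌈a⌉ : ℝ)| := by
        rcases le_abs.1 ha with h | h
        · exact lt_of_lt_of_le (by linarith) (le_abs_self _)
        · exact lt_of_lt_of_le (by linarith) (neg_le_abs _)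
      exact_mod_cast this
    obtain ⟨n, hn⟩ : ∃ n : ℕ, |⌈a⌉| = n + 1 := ⟨(|⌈a⌉| - 1).toNat, by omega⟩
    have hn1 : 1 ≤ n := by omega
    have h := (key n hn1).trans (le_ncard_parameterSlice (φ := φ) (P := P) (by omega) hp hn1
      (t := ⌈a⌉) (by exact_mod_cast hn))
    have hpos : 0 < (parameterSlice (verdictParameter φ P) ⌈a⌉).ncard := by
      exact_mod_cast lt_of_lt_of_le (show 0 < √2 ^ n / D by positivity) h
    obtain ⟨x, hx⟩ := Set.nonempty_of_ncard_ne_zero hpos.ne'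
    refine ⟨x, ?_⟩
    rw [parameterWindow, Set.mem_ofPred_eq, show verdictParameter φ P x = ⌈a⌉ from hx]
    exact ⟨h₁, h₂.le⟩
  · have hlog : 0 < Real.log √2 := Real.log_pos (by
      rw [Real.lt_sqrt zero_le_one]; norm_num)
    have hlog' : 0 < Real.log (2 * Fintype.card A) := Real.log_pos (by linarith)
    refine ⟨δ + 2, Real.log √2, Real.log (2 * Fintype.card A),
      Real.exp (-(Real.log √2 * (δ + 1))) / D, Real.exp (Real.log (2 * Fintype.card A) * δ),
      hlog, hlog', by positivity, by positivity, fun a ha hne => ?_⟩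
    rw [sub_zero] at ha ⊢
    have habs : ∀ {x : List A}, x ∈ parameterWindow (verdictParameter φ P) a δ →
        |(|verdictParameter φ P x| - |a|)| ≤ δ := by
      rintro x ⟨h₁, h₂⟩
      refine (abs_abs_sub_abs_le _ _).trans (abs_le.2 ⟨?_, ?_⟩) <;> linarith
    have hsub : parameterWindow (verdictParameter φ P) a δ ⊆ {x | (φ x).length ≤ ⌊|a| + δ⌋₊} := by
      intro x hx
      refine Nat.le_floor ?_
      have h := abs_verdictParameter (φ := φ) (P := P) x
      have := abs_le.1 (habs hx)
      linarith
    have hfin := (finite_length_le φ ⌊|a| + δ⌋₊).subset hsub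
    refine ⟨hfin, ?_, ?_⟩
    · obtain ⟨x, hx⟩ := hne
      have h := abs_verdictParameter (φ := φ) (P := P) x
      have hge : |a| - δ ≤ |verdictParameter φ P x| := by
        have := abs_le.1 (habs hx)
        linarith
      have hn : 1 ≤ (φ x).length := by
        have : (1 : ℝ) ≤ (φ x).length := by linarith
        exact_mod_cast this
      have h₁ := (key _ hn).trans (le_ncard_parameterSlice (by omega) hp hn h)
      have h₂ : (parameterSlice (verdictParameter φ P) (verdictParameter φ P x)).ncard ≤
          (parameterWindow (verdictParameter φ P) a δ).ncard :=
        Set.ncard_le_ncard (fun y hy => by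
          rw [parameterWindow, Set.mem_ofPred_eq, show verdictParameter φ P y = _ from hy]
          exact hx) hfin
      refine le_trans ?_ (h₁.trans (by exact_mod_cast h₂))
      rw [div_mul_eq_mul_div, ← Real.exp_add]
      gcongr
      rw [← Real.exp_log (show (0 : ℝ) < √2 ^ (φ x).length by positivity), Real.log_pow]
      gcongr
      nlinarith
    · refine le_trans (b := ((2 * Fintype.card A) ^ ⌊|a| + δ⌋₊ : ℝ)) ?_ ?_
      · exact_mod_cast (Set.ncard_le_ncard hsub (finite_length_le φ _)).trans
          (ncard_length_le φ _)
      · rw [← Real.exp_log (show (0 : ℝ) < (2 * Fintype.card A) ^ ⌊|a| + δ⌋₊ by positivity),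
          Real.log_pow, ← Real.exp_add]
        gcongr
        have := Nat.floor_le (show 0 ≤ |a| + δ by positivity)
        nlinarith

theorem one_sub_le_acceptingFraction (hA : 0 < Fintype.card A) (hp : IsBalancedBy L φ P p)
    (hacc : ∀ x, P x = .accept → x ∈ L) {n : ℕ} (hn : 1 ≤ n) {b : ℝ}
    (hb : fractionOf (sizeClass φ n) {x | P x = .undecided} ≤ b) :
    1 - p.eval (n : ℝ) * b ≤
      acceptingFraction L (parameterSlice (verdictParameter φ P) (n + 1)) := by
  have hpn := (hp.1 n hn).1
  have hA' : (0 : ℝ) < Fintype.card A := by exact_mod_cast hA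
  have hv := le_ncard_parameterSlice hA hp hn (t := n + 1) (abs_of_pos (by positivity))
  refine le_trans (le_of_eq ?_) (one_sub_div_le_acceptingFraction L (finite_parameterSlice φ P _)
    (u := b * (Fintype.card A : ℝ) ^ n) (by positivity) ?_ hv)
  · field_simp
  · refine le_trans ?_ (ncard_le_mul_of_fractionOf_le φ hb hA)
    rw [parameterSlice_add_one]
    refine Nat.cast_le.2 (Set.ncard_le_ncard ?_ ((finite_sizeClass φ n).inter_of_left _))
    rintro x ⟨⟨h₁, h₂⟩, h₃⟩
    refine ⟨h₁, ?_⟩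
    simp only [Set.mem_ofPred_eq] at h₂ h₃ ⊢
    cases h : P x with
    | accept => exact absurd (hacc x h) h₃
    | reject => exact absurd h h₂
    | undecided => rfl

theorem exhibitsPhaseTransition_of_balanced (hA : 2 ≤ Fintype.card A)
    (hP : IsRoughPWitness L φ P) (hp : IsBalancedBy L φ P p) : ExhibitsPhaseTransition L := by
  obtain ⟨hφ, hPt, hacc, hrej, c, hc₀, hc₁, hc⟩ := hP
  have : Nonempty A := Fintype.card_pos_iff.1 (by omega)
  -- At `n = 0` balance gives nothing; the value `1` makes the lower bound trivial for all `t ≤ 1`,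
  -- in particular for the negative slices.
  let e : ℕ → ℝ := fun n => if n = 0 then 1 else p.eval (n : ℝ) * c ^ n
  have he : Tendsto e atTop (𝓝 0) := by
    refine (tendsto_eval_mul_pow p hc₀ hc₁).congr' ?_
    filter_upwards [eventually_ge_atTop 1] with n hn
    exact (if_neg (by omega)).symm
  have he₀ : ∀ n, 0 ≤ e n := by
    intro n
    simp only [e]
    split_ifs with h
    · exact zero_le_one
    · exact mul_nonneg (hp.1 n (by omega)).1.le (pow_nonneg hc₀ n)
  obtain ⟨h, hanti, hlim, hmaj⟩ := exists_antitone_majorant he he₀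
  have hlower : ∀ t : ℝ, (parameterSlice (verdictParameter φ P) t).Nonempty →
      1 - h t ≤ acceptingFraction L (parameterSlice (verdictParameter φ P) t) := by
    rintro t ⟨x, rfl⟩
    have hnn := acceptingFraction_nonneg L
      (parameterSlice (verdictParameter φ P) (verdictParameter φ P x))
    by_cases ht : verdictParameter φ P x ≤ ((0 : ℕ) : ℝ) + 1
    · have := hmaj 0 _ ht
      simp only [e, if_true] at this
      linarith
    · have hx : P x ≠ .reject := by
        intro hx
        rw [verdictParameter_of_reject hx] at ht
        refine ht ?_
        have : (0 : ℝ) ≤ (φ x).length := by positivity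
        push_cast
        linarith
      rw [verdictParameter_of_ne_reject hx] at ht ⊢
      have hn : (φ x).length ≠ 0 := by
        intro hn
        rw [hn] at ht
        exact ht le_rfl
      have h₁ := hmaj (φ x).length _ le_rfl
      simp only [e, if_neg hn] at h₁
      have h₂ := one_sub_le_acceptingFraction (by omega) hp hacc (n := (φ x).length) (by omega)
        (hc _ (by omega))
      linarith
  have hlim' : Tendsto (fun t => 1 - h t) atTop (𝓝 1) := by
    simpa using hlim.const_sub 1
  refine ⟨verdictParameter φ P, isParameter_verdictParameter hφ.1 hPt,
    ⟨?_, fun t => 1 - h t, fun s t hst => sub_le_sub_left (hanti hst) 1, hlim',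
      fun t ht _ => hlower t ht⟩,
    ⟨?_, fun t => if t < 0 then 0 else 1, ?_, ?_, ?_⟩, 0,
    growsExponentiallyFrom_verdictParameter hA hp⟩
  · refine tendsto_of_tendsto_of_tendsto_of_le_of_le' (hlim'.mono_left inf_le_left)
      tendsto_const_nhds ?_ ?_
    · exact eventually_inf_principal.2 (Eventually.of_forall hlower)
    · exact Eventually.of_forall fun t => acceptingFraction_le_one L (finite_parameterSlice φ P t)
  · refine tendsto_const_nhds.congr' ?_
    refine Filter.Eventually.filter_mono inf_le_left ?_
    filter_upwards [eventually_lt_atBot 0] with t ht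
    exact (acceptingFraction_parameterSlice_of_neg hrej ht).symm
  · intro s t hst
    dsimp only
    split_ifs with h₁ h₂ h₂
    exacts [le_rfl, zero_le_one, absurd (hst.trans_lt h₂) h₁, le_rfl]
  · refine tendsto_const_nhds.congr' ?_
    filter_upwards [eventually_lt_atBot 0] with t ht
    exact (if_pos ht).symm
  · intro t _ hfin
    dsimp only
    split_ifs with ht
    · exact (acceptingFraction_parameterSlice_of_neg hrej ht).le
    · exact acceptingFraction_le_one L hfin

end PhaseTransition

theorem theorem2 (A : Type) [Fintype A] [NeZero (Fintype.card A)]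
    (hcard : 2 ≤ Fintype.card A) (hodd : Odd (Fintype.card A))
    (L : Language A) (hL : IsAdequatelyBalanced L) :
    ExhibitsPhaseTransition L := by
  obtain ⟨-, φ, P, p, hP, hp, -⟩ := hL
  exact exhibitsPhaseTransition_of_balanced hcard hP hp

end
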